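/- **Notation.** Let $n\ge 3$ and $1\le d\le n-2$. Write $x=(x',x_n)=(y,z,x_n)\in\mathbb R^n\equiv\mathbb R^d\times\mathbb R^{n-1-d}\times\mathbb R$ with $x'=(y,z)\in\mathbb R^{n-1}$, let $\vec e_n=(0,\dots,0,1)$, and let $\|\cdot\|$ be the Euclidean norm. For $\rho>0$ and $T\subset\mathbb R^n$ let $\mathcal C_\rho(T):=T+\{(v',v_n)\in\mathbb R^n:\|v'\|\le\rho v_n\}$ be the vertical cone of radius $\rho$ over $T$, and let $T^{\uparrow}:=\{p+\lambda\vec e_n: p\in T,\ \lambda\ge0\}$ be the positive (upward) cylinder over $T$. *Pecker's polynomials* are $P_1(\mathtt y_1,\mathtt t):=\mathtt t-\mathtt y_1$ and $$P_{m+1}(\mathtt y_1,\dots,\mathtt y_{m+1},\mathtt t):=P_m\big(a_1,\dots,a_m,(\mathtt t-(\mathtt y_1+\cdots+\mathtt y_{m+1}))^2\big),\qquad a_k:=\mathtt y_{k+1}(\mathtt y_1+\cdots+\mathtt y_k).$$ Put $C_m:=1-\sqrt{(m-1)/m}$, $\ell(m):=(m+1)2^{m-1}-m^2+m$ and, for $m\ge2$,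 let $$Q_m(\mathtt y_1,\dots,\mathtt y_m,\mathtt t):=\Big(\frac{\mathtt t}{C_m}+\mathtt y_m\Big)^{\ell(m)}(\mathtt y_1\cdots\mathtt y_m)^{2^{m-1}}P_m\Big(\mathtt y_1,\dots,\mathtt y_{m-1},\frac1{\mathtt y_1\cdots\mathtt y_m},\mathtt t\Big),$$ which is a polynomial. For polynomials $h_1,\dots,h_m,h_{m+1}\in\mathbb R[x']$ with $h_{m+1}>1$ on $\mathbb R^{n-1}$ and $\mathbf h:=(h_1,\dots,h_{m+1})$, set $$Q_{\mathbf h}(x',x_n):=h_{m+1}(x')^{2\ell(m+1)+2^{m+1}}\,Q_{m+1}\Big(h_1(x'),\dots,h_m(x'),1,\frac{C_{m+1}x_n^2}{h_{m+1}(x')^2}\Big)\in\mathbb R[x],$$ $$\mathcal A_{\mathbf h}:=\{h_1>0,\dots,h_m>0,\ x_n=0\}\subset\mathbb R^n,\qquad \mathcal S_{\mathbf h}:=\{Q_{\mathbf h}\le0,\ x_n>0\}^{\uparrow}.$$ **Theorem.** Let $g_1,\dots,g_r\in\mathbb R[y]$, let $\varepsilon,\delta>0$, put $m:=r+2(n-1-d)$,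 and let $g_{m+1}\in\mathbb R[x']$ satisfy $g_{m+1}\ge1+\varepsilon\frac{\sqrt{n-d-1}}{\delta}$ on $\mathbb R^{n-1}$. Consider the tuple $$\hat{\mathbf g}_\varepsilon:=(g_1,\dots,g_r,\ x_{d+1}+\varepsilon,\dots,x_{n-1}+\varepsilon,\ \varepsilon-x_{d+1},\dots,\varepsilon-x_{n-1},\ g_{m+1})$$ and write $Q:=Q_{\hat{\mathbf g}_\varepsilon}$, $S:=\mathcal S_{\hat{\mathbf g}_\varepsilon}$ and $$D:=\mathcal A_{\hat{\mathbf g}_\varepsilon}\cap\{x_{d+1}=0,\dots,x_n=0\}=\{g_1>0,\dots,g_r>0,\ x_{d+1}=0,\dots,x_n=0\}\subset\mathbb R^n.$$ Let $P\in\mathbb R[x]$ satisfy $P>1$ on $S$. For each integer $k\ge1$ consider the polynomial map $$f_k:\mathbb R^n\to\mathbb R^n,\quad (y,z,x_n)\mapsto\big(y,\ A(x)z,\ B_k(x)x_n\big),\qquad A:=(1+P^2Q)^2,\quad B_k:=\frac{A+A^k}{2}.$$ Then: 1. for every $k\ge1$ and every $x'\in\mathbb R^{n-1}$, $\ \lim_{x_n\to+\infty}B_k(x',x_n)\,x_n=+\infty$;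 2. $S\subset\mathcal C_\delta(D)$; 3. for every $k\ge1$, $\ D^{\uparrow}\subset f_k(S)\subset\mathcal C_{2\delta}(D)$; 4. for every $\Delta>2\delta$ there exists $k_0\ge1$ such that for all $k\ge k_0$ and all $x\in\mathcal C_\Delta(D)\setminus S$ one has $f_k(x)\in\mathcal C_{2\delta}(\{x\})$. -/

import Mathlib

open Filter Topology
open scoped Pointwise

noncomputable section

namespace PolyCone

/-! Pecker's polynomials and their modification -/

/-- `pecker m y t` is Pecker's polynomial `P_{m+1}(y_1, …, y_{m+1}, t)` (the index is
one more than `m`; the entries of `y : Fin (m + 1) → R` are numbered from `0`), evaluated in a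
commutative ring `R`:
`P_1(y_1, t) = t - y_1` and
`P_{m+1}(y_1, …, y_{m+1}, t) = P_m(a_1, …, a_m, (t - (y_1 + ⋯ + y_{m+1}))^2)` with
`a_k = y_{k+1} (y_1 + ⋯ + y_k)`. -/
def pecker {R : Type*} [CommRing R] : (m : ℕ) → (Fin (m + 1) → R) → R → R
  | 0, y, t => t - y 0
  | m + 1, y, t =>
      pecker m (fun k : Fin (m + 1) => y k.succ * ∑ j ∈ Finset.Iic k.castSucc, y j)
        ((t - ∑ j, y j) ^ 2)

/-- `C_M = 1 - √((M - 1) / M)`. -/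
def peckerConst (M : ℕ) : ℝ := 1 - Real.sqrt (((M : ℝ) - 1) / M)

/-- `ℓ(M) = (M + 1) 2^{M-1} - M² + M` (written so that the subtraction does not truncate). -/
def peckerExp (M : ℕ) : ℕ := (M + 1) * 2 ^ (M - 1) + M - M ^ 2

/-- The modified Pecker polynomial
`Q_M(y_1, …, y_M, t) = (t / C_M + y_M)^{ℓ(M)} w^{2^{M-1}} P_M(y_1, …, y_{M-1}, 1 / w, t)`,
`w = y_1 ⋯ y_M`, for `M = m + 1`. As `P_M` is homogeneous of degree `2^{M-1}`, the denominators are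
cleared by writing the last two factors as `P_M(w y_1, …, w y_{M-1}, 1, w t)`, which is polynomial
in `(y, t)`; see `modPecker_eq` for the original expression. -/
def modPecker (m : ℕ) (y : Fin (m + 1) → ℝ) (t : ℝ) : ℝ :=
  (t / peckerConst (m + 1) + y (Fin.last m)) ^ peckerExp (m + 1) *
    pecker m (Fin.snoc (α := fun _ => ℝ) (fun i : Fin m => (∏ j, y j) * y i.castSucc) 1)
      ((∏ j, y j) * t)

/-- For an admissible tuple `(g_1, …, g_m, G)` of polynomials in `x' = (x_1, …, x_N)`, the polynomial
`G^{2 ℓ(m+1) + 2^{m+1}} Q_{m+1}(g_1, …, g_m, 1, C_{m+1} x_n² / G²)` in `x = (x', x_n)`, `n = N + 1`,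
with its denominators cleared; see `eval_polQ` for the original expression. -/
def polQ {N m : ℕ} (g : Fin m → MvPolynomial (Fin N) ℝ) (G : MvPolynomial (Fin N) ℝ) :
    MvPolynomial (Fin (N + 1)) ℝ :=
  let up : MvPolynomial (Fin N) ℝ → MvPolynomial (Fin (N + 1)) ℝ := MvPolynomial.rename Fin.castSucc
  let xn : MvPolynomial (Fin (N + 1)) ℝ := MvPolynomial.X (Fin.last N)
  let w : MvPolynomial (Fin (N + 1)) ℝ := ∏ j, up (g j)
  (xn ^ 2 + up G ^ 2) ^ peckerExp (m + 1) *
    pecker m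
      (Fin.snoc (α := fun _ => MvPolynomial (Fin (N + 1)) ℝ)
        (fun i : Fin m => up G ^ 2 * (w * up (g i))) (up G ^ 2))
      (MvPolynomial.C (peckerConst (m + 1)) * (w * xn ^ 2))

/-! Points, cylinders and cones in `ℝⁿ`, `n = N + 1` -/

/-- The part `x' = (x_1, …, x_{n-1})` of `x = (x', x_n)`. -/
def base {N : ℕ} (x : EuclideanSpace ℝ (Fin (N + 1))) : EuclideanSpace ℝ (Fin N) :=
  WithLp.toLp 2 fun i => x i.castSucc

/-- The point `(x', t)`. -/
def point {N : ℕ} (x' : EuclideanSpace ℝ (Fin N)) (t : ℝ) : EuclideanSpace ℝ (Fin (N + 1)) :=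
  WithLp.toLp 2 (Fin.snoc (α := fun _ => ℝ) (fun i => x' i) t)

/-- The last vector of the standard basis. -/
def en (N : ℕ) : EuclideanSpace ℝ (Fin (N + 1)) := EuclideanSpace.single (Fin.last N) 1

/-- The value of a polynomial at a point. -/
def ev {n : ℕ} (p : MvPolynomial (Fin n) ℝ) (x : EuclideanSpace ℝ (Fin n)) : ℝ :=
  MvPolynomial.eval (fun i => x i) p

/-- The polynomial map with components `F`. -/
def polyMap {n : ℕ} (F : Fin n → MvPolynomial (Fin n) ℝ) (x : EuclideanSpace ℝ (Fin n)) :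
    EuclideanSpace ℝ (Fin n) :=
  WithLp.toLp 2 fun i => ev (F i) x

/-- The positive cylinder of base `X` in the direction `v`. -/
def posCylinder {n : ℕ} (X : Set (EuclideanSpace ℝ (Fin n))) (v : EuclideanSpace ℝ (Fin n)) :
    Set (EuclideanSpace ℝ (Fin n)) :=
  {p | ∃ x ∈ X, ∃ c : ℝ, 0 ≤ c ∧ p = x + c • v}

/-- The vertical cone `{(v', v_n) : ‖v'‖ ≤ δ v_n}` of radius `δ`. -/
def verticalCone {N : ℕ} (δ : ℝ) : Set (EuclideanSpace ℝ (Fin (N + 1))) :=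
  {v | ‖base v‖ ≤ δ * v (Fin.last N)}

/-- The vertical cone of radius `δ` over `T`. -/
def coneOver {N : ℕ} (δ : ℝ) (T : Set (EuclideanSpace ℝ (Fin (N + 1)))) :
    Set (EuclideanSpace ℝ (Fin (N + 1))) :=
  T + verticalCone δ

/-! Sets associated to an admissible tuple -/

/-- `{g_1 > 0, …, g_m > 0, x_n = 0}`. -/
def setA {N m : ℕ} (g : Fin m → MvPolynomial (Fin N) ℝ) : Set (EuclideanSpace ℝ (Fin (N + 1))) :=
  {x | (∀ i, 0 < ev (g i) (base x)) ∧ x (Fin.last N) = 0}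

/-- The positive vertical cylinder over `{polQ g G ≤ 0, x_n > 0}`. -/
def setS {N m : ℕ} (g : Fin m → MvPolynomial (Fin N) ℝ) (G : MvPolynomial (Fin N) ℝ) :
    Set (EuclideanSpace ℝ (Fin (N + 1))) :=
  posCylinder {x | ev (polQ g G) x ≤ 0 ∧ 0 < x (Fin.last N)} (en N)

/-! The lower-dimensional situation: `ℝⁿ = ℝ^d × ℝ^q × ℝ`, `n = d + q + 1`, `x = (y, z, x_n)` -/

/-- The first `m = r + 2 q` entries of the thickened tuple:
`g_1, …, g_r, x_{d+1} + ε, …, x_{d+q} + ε, ε - x_{d+1}, …, ε - x_{d+q}`. -/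
def thicken {d q r : ℕ} (g : Fin r → MvPolynomial (Fin d) ℝ) (ε : ℝ) :
    Fin (r + q + q) → MvPolynomial (Fin (d + q)) ℝ :=
  Fin.append
    (Fin.append (fun i => MvPolynomial.rename (Fin.castAdd q) (g i))
      (fun j : Fin q => MvPolynomial.X (Fin.natAdd d j) + MvPolynomial.C ε))
    (fun j : Fin q => MvPolynomial.C ε - MvPolynomial.X (Fin.natAdd d j))

/-- The set `D = setA (thicken g ε) ∩ {x_{d+1} = 0, …, x_n = 0}`. -/
def setD {d q r : ℕ} (g : Fin r → MvPolynomial (Fin d) ℝ) (ε : ℝ) :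
    Set (EuclideanSpace ℝ (Fin (d + q + 1))) :=
  setA (thicken (q := q) g ε) ∩
    {x | (∀ j : Fin q, x (Fin.natAdd d j).castSucc = 0) ∧ x (Fin.last (d + q)) = 0}

/-- `A = (1 + P² Q)²`. -/
def polA {n : ℕ} (P Q : MvPolynomial (Fin n) ℝ) : MvPolynomial (Fin n) ℝ := (1 + P ^ 2 * Q) ^ 2

/-- `B_k = (A + A^k) / 2`. -/
def polB {n : ℕ} (P Q : MvPolynomial (Fin n) ℝ) (k : ℕ) : MvPolynomial (Fin n) ℝ :=
  MvPolynomial.C (1 / 2) * (polA P Q + polA P Q ^ k)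

/-- The polynomial map `f_k(y, z, x_n) = (y, A z, B_k x_n)`. -/
def coneMap {d q : ℕ} (P Q : MvPolynomial (Fin (d + q + 1)) ℝ) (k : ℕ) :
    EuclideanSpace ℝ (Fin (d + q + 1)) → EuclideanSpace ℝ (Fin (d + q + 1)) :=
  polyMap
    (Fin.snoc (α := fun _ => MvPolynomial (Fin (d + q + 1)) ℝ)
      (Fin.append (fun i : Fin d => MvPolynomial.X (Fin.castAdd q i).castSucc)
        (fun j : Fin q => polA P Q * MvPolynomial.X (Fin.natAdd d j).castSucc))
      (polB P Q k * MvPolynomial.X (Fin.last (d + q))))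

/-! The polynomials above are the usual ones -/

theorem pecker_smul {R : Type*} [CommRing R] (c : R) (m : ℕ) (y : Fin (m + 1) → R) (t : R) :
    pecker m (fun i => c * y i) (c * t) = c ^ 2 ^ m * pecker m y t := by
  induction m generalizing c t with
  | zero => simp [pecker]; ring
  | succ m ih =>
    have h1 : (c * t - ∑ j, c * y j) ^ 2 = c ^ 2 * (t - ∑ j, y j) ^ 2 := by
      rw [← Finset.mul_sum]; ring
    have h2 : (fun k : Fin (m + 1) => c * y k.succ * ∑ j ∈ Finset.Iic k.castSucc, c * y j) =
        fun k : Fin (m + 1) => c ^ 2 * (y k.succ * ∑ j ∈ Finset.Iic k.castSucc, y j) := by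
      funext k; rw [← Finset.mul_sum]; ring
    simp only [pecker]
    rw [h1, h2, ih, ← pow_mul, pow_succ' 2 m]

theorem map_pecker {R S : Type*} [CommRing R] [CommRing S] (f : R →+* S) (m : ℕ)
    (y : Fin (m + 1) → R) (t : R) :
    f (pecker m y t) = pecker m (fun i => f (y i)) (f t) := by
  induction m generalizing t with
  | zero => simp [pecker]
  | succ m ih => simp only [pecker, ih, map_mul, map_sum, map_pow, map_sub]

theorem modPecker_eq (m : ℕ) (y : Fin (m + 1) → ℝ) (t : ℝ) (hw : ∏ j, y j ≠ 0) :
    modPecker m y t =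
      (t / peckerConst (m + 1) + y (Fin.last m)) ^ peckerExp (m + 1) * (∏ j, y j) ^ 2 ^ m *
        pecker m (Fin.snoc (α := fun _ => ℝ) (fun i : Fin m => y i.castSucc) (1 / ∏ j, y j)) t := by
  rw [modPecker, mul_assoc, ← pecker_smul]
  congr 2
  funext i
  refine Fin.lastCases ?_ (fun i => ?_) i
  · simp [hw]
  · simp

theorem peckerConst_pos (m : ℕ) : 0 < peckerConst (m + 1) := by
  have h : Real.sqrt ((((m + 1 : ℕ) : ℝ) - 1) / (m + 1 : ℕ)) < 1 := by
    rw [Real.sqrt_lt' one_pos, div_lt_iff₀ (by positivity)]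
    push_cast; linarith
  unfold peckerConst; linarith

theorem eval_polQ {N m : ℕ} (g : Fin m → MvPolynomial (Fin N) ℝ) (G : MvPolynomial (Fin N) ℝ)
    (x : EuclideanSpace ℝ (Fin (N + 1))) (hG : ev G (base x) ≠ 0) :
    ev (polQ g G) x =
      ev G (base x) ^ (2 * peckerExp (m + 1) + 2 ^ (m + 1)) *
        modPecker m (Fin.snoc (α := fun _ => ℝ) (fun i => ev (g i) (base x)) 1)
          (x (Fin.last N) ^ 2 * peckerConst (m + 1) / ev G (base x) ^ 2) := by
  have hC := (peckerConst_pos m).ne'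
  have hup : ∀ p : MvPolynomial (Fin N) ℝ,
      MvPolynomial.eval (fun i => x i) (MvPolynomial.rename Fin.castSucc p) = ev p (base x) := by
    intro p
    rw [MvPolynomial.eval_rename]
    rfl
  set γ := ev G (base x) with hγ
  have hprod : ∏ j : Fin (m + 1), (Fin.snoc (α := fun _ => ℝ) (fun i => ev (g i) (base x)) 1 :
      Fin (m + 1) → ℝ) j = ∏ i, ev (g i) (base x) := by
    simp [Fin.prod_univ_castSucc]
  rw [modPecker, hprod]
  set w := ∏ i, ev (g i) (base x) with hw
  have e1 : γ ^ (2 * peckerExp (m + 1) + 2 ^ (m + 1)) =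
      (γ ^ 2) ^ peckerExp (m + 1) * (γ ^ 2) ^ 2 ^ m := by
    rw [pow_add, ← pow_mul, ← pow_mul, pow_succ' 2 m]
  have e2 : ∀ a b c e : ℝ, a * b * (c * e) = (a * c) * (b * e) := by intros; ring
  rw [e1, e2, ← mul_pow, ← pecker_smul]
  unfold ev polQ
  simp only [map_mul, map_pow, map_add, map_pecker, MvPolynomial.eval_X, MvPolynomial.eval_C,
    map_prod, hup]
  rw [← hγ, ← hw]
  congr 2
  · simp; field_simp
  · funext i
    refine Fin.lastCases ?_ (fun i => ?_) i
    · simp [hup, ← hγ]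
    · simp only [Fin.snoc_castSucc, map_mul, map_pow, map_prod, hup, ← hγ, ← hw]
      rfl
  · field_simp

end PolyCone

end

open PolyCone

/-!
For `t ≥ 0`, the inequality `P_{m+1}(y, t) ≤ 0` unwinds by induction: applied to the arguments
`a_k` and `(t - S)²`, where `S = y_1 + ⋯ + y_{m+1}`, the induction hypothesis gives `a_k ≥ 0` and
`(t - S)² ≤ 2 (a_1 + ⋯ + a_m)`. As `S² = ∑ y_i² + 2 ∑ a_k`, Cauchy-Schwarz bounds the right-hand
side by `(1 - C_{m+1})² S²`. Hence all `y_i` are nonnegative and `C_{m+1} S ≤ t ≤ 2 S`.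
Conversely, over positive `y` the recursion yields some `t ≥ S` at which `P_{m+1}(y, t)` is at
most an explicit negative constant.

The last two arguments of `Q_{m+1}(a_1, …, a_m, 1, t)` amount to evaluating `P_{m+1}` at a tuple
of product `1`, whose sum is at least `1`. So `Q_h ≤ 0` forces `h_i > 0` and `x_n ≥ h_{m+1}`, and
`Q_h` takes a value at most `-1` on each vertical line over `{h_1 > 0, …, h_m > 0}`. On `S` this
gives `‖z‖ ≤ ε √(n - d - 1) ≤ δ x_n`.

Where `Q ≤ -1` and `P ≥ 1` one has `1 + P² Q ≤ 0`, whereas `Q > 0` for large `x_n`; hence `A`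
vanishes somewhere on each such line, and by continuity `B_k x_n` takes all nonnegative values
above that zero. Outside `S` one has `Q ≥ 0`, so `A ≥ 1`, and Bernoulli's inequality
`A^k - 1 ≥ k (A - 1)` makes the vertical displacement dominate the horizontal one for large `k`.
-/

namespace PolyCone

section PositiveFamily

variable {ι : Type*} [Fintype ι] {y : ι → ℝ}

theorem one_le_sum_of_prod_eq_one [Nonempty ι] (hy : ∀ i, 0 ≤ y i) (hprod : ∏ i, y i = 1) :
    1 ≤ ∑ i, y i := by
  have hle : ∀ i, y i ≤ ∑ j, y j := fun i =>
    Finset.single_le_sum (fun j _ => hy j) (Finset.mem_univ i)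
  rw [← one_le_pow_iff_of_nonneg (Finset.sum_nonneg fun i _ => hy i)
    (Fintype.card_ne_zero (α := ι))]
  calc 1 = ∏ i, y i := hprod.symm
    _ ≤ ∏ _i : ι, ∑ j, y j := Finset.prod_le_prod (fun i _ => hy i) fun i _ => hle i
    _ = (∑ i, y i) ^ Fintype.card ι := by rw [Finset.prod_const, Finset.card_univ]

theorem inv_sum_pow_le_of_prod_eq_one (hy : ∀ i, 0 < y i) (hprod : ∏ i, y i = 1) (i : ι) :
    ((∑ j, y j) ^ (Fintype.card ι - 1))⁻¹ ≤ y i := by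
  classical
  have hle : ∀ j, y j ≤ ∑ k, y k := fun j =>
    Finset.single_le_sum (fun k _ => (hy k).le) (Finset.mem_univ j)
  have hsum : 0 < ∑ j, y j := (hy i).trans_le (hle i)
  rw [inv_le_iff_one_le_mul₀ (by positivity)]
  calc 1 = y i * ∏ j ∈ Finset.univ.erase i, y j := by
        rw [Finset.mul_prod_erase _ _ (Finset.mem_univ i), hprod]
    _ ≤ y i * ∏ _j ∈ Finset.univ.erase i, ∑ k, y k :=
        mul_le_mul_of_nonneg_left
          (Finset.prod_le_prod (fun j _ => (hy j).le) fun j _ => hle j) (hy i).le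
    _ = y i * (∑ j, y j) ^ (Fintype.card ι - 1) := by
        rw [Finset.prod_const, Finset.card_erase_of_mem (Finset.mem_univ i), Finset.card_univ]

end PositiveFamily

section PeckerArgs

/-- The entries `a_k = y_{k+1} (y_1 + ⋯ + y_k)` at which the recursion for Pecker's polynomials
evaluates the preceding polynomial. -/
def peckerArgs {R : Type*} [CommSemiring R] {n : ℕ} (y : Fin (n + 1) → R) (k : Fin n) : R :=
  y k.succ * ∑ j ∈ Finset.Iic k.castSucc, y j

variable {n : ℕ}

theorem pecker_succ {R : Type*} [CommRing R] (y : Fin (n + 2) → R) (t : R) :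
    pecker (n + 1) y t = pecker n (peckerArgs y) ((t - ∑ i, y i) ^ 2) :=
  rfl

theorem peckerArgs_castSucc {R : Type*} [CommSemiring R] (y : Fin (n + 2) → R) (k : Fin n) :
    peckerArgs y k.castSucc = peckerArgs (fun i => y i.castSucc) k := by
  rw [peckerArgs, peckerArgs, Fin.sum_Iic_castSucc, Fin.succ_castSucc]

theorem peckerArgs_last {R : Type*} [CommSemiring R] (y : Fin (n + 2) → R) :
    peckerArgs y (Fin.last n) = y (Fin.last _) * ∑ i : Fin (n + 1), y i.castSucc := by
  rw [peckerArgs, Fin.sum_Iic_castSucc, Fin.succ_last,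
    show Finset.Iic (Fin.last n) = Finset.univ from Finset.Iic_top]

theorem sq_sum_eq_sum_sq_add_two_mul_sum_peckerArgs {R : Type*} [CommSemiring R]
    (y : Fin (n + 1) → R) :
    (∑ i, y i) ^ 2 = ∑ i, y i ^ 2 + 2 * ∑ k, peckerArgs y k := by
  induction n with
  | zero => simp
  | succ n ih =>
    simp only [Fin.sum_univ_castSucc (n := n + 1), Fin.sum_univ_castSucc (peckerArgs y),
      peckerArgs_castSucc, peckerArgs_last, add_sq, ih]
    ring

theorem one_sub_peckerConst_sq (n : ℕ) : (1 - peckerConst (n + 1)) ^ 2 = n / (n + 1) := by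
  rw [peckerConst, sub_sub_cancel, Nat.cast_succ, add_sub_cancel_right,
    Real.sq_sqrt (by positivity)]

theorem peckerConst_le_one (M : ℕ) : peckerConst M ≤ 1 :=
  sub_le_self _ (Real.sqrt_nonneg _)

theorem two_mul_sum_peckerArgs_le (y : Fin (n + 1) → ℝ) :
    2 * ∑ k, peckerArgs y k ≤ ((1 - peckerConst (n + 1)) * ∑ i, y i) ^ 2 := by
  have hCS : (∑ i, y i) ^ 2 ≤ (n + 1) * ∑ i, y i ^ 2 := by
    simpa using sq_sum_le_card_mul_sum_sq (s := Finset.univ) (f := y)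
  have hsq := sq_sum_eq_sum_sq_add_two_mul_sum_peckerArgs y
  rw [mul_pow, one_sub_peckerConst_sq, div_mul_eq_mul_div, le_div_iff₀ (by positivity)]
  nlinarith

theorem nonneg_or_nonpos_of_peckerArgs_nonneg {y : Fin (n + 1) → ℝ}
    (h : ∀ k, 0 ≤ peckerArgs y k) : (∀ i, 0 ≤ y i) ∨ ∀ i, y i ≤ 0 := by
  induction n with
  | zero => simpa [Fin.forall_fin_one] using le_total 0 (y 0)
  | succ n ih =>
    obtain ⟨hinit, hlast⟩ := Fin.forall_fin_succ'.1 h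
    simp only [peckerArgs_castSucc, peckerArgs_last] at hinit hlast
    rw [Fin.forall_fin_succ' (P := fun i => 0 ≤ y i), Fin.forall_fin_succ' (P := fun i => y i ≤ 0)]
    by_cases hzero : ∀ i : Fin (n + 1), y i.castSucc = 0
    · exact (le_total 0 (y (Fin.last _))).imp (⟨fun i => (hzero i).ge, ·⟩)
        (⟨fun i => (hzero i).le, ·⟩)
    · push Not at hzero
      obtain ⟨i, hi⟩ := hzero
      refine (ih hinit).imp (fun hy => ⟨hy, ?_⟩) fun hy => ⟨hy, ?_⟩
      · exact nonneg_of_mul_nonneg_left hlast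
          (Finset.sum_pos' (fun i _ => hy i) ⟨i, Finset.mem_univ i, (hy i).lt_of_ne' hi⟩)
      · exact nonpos_of_mul_nonneg_left hlast
          (Finset.sum_neg' (fun i _ => hy i) ⟨i, Finset.mem_univ i, (hy i).lt_of_ne hi⟩)

theorem nonneg_of_peckerArgs_nonneg {y : Fin (n + 1) → ℝ} {t : ℝ} (ht : 0 ≤ t)
    (hargs : ∀ k, 0 ≤ peckerArgs y k)
    (habs : |t - ∑ i, y i| ≤ (1 - peckerConst (n + 1)) * |∑ i, y i|) (i : Fin (n + 1)) :
    0 ≤ y i := by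
  obtain hy | hy := nonneg_or_nonpos_of_peckerArgs_nonneg hargs
  · exact hy i
  have hS : ∑ i, y i ≤ 0 := Finset.sum_nonpos fun i _ => hy i
  have hS0 : ∑ i, y i = 0 := by
    rw [abs_of_nonpos hS] at habs
    have := le_abs_self (t - ∑ i, y i)
    have hC := peckerConst_pos n
    nlinarith
  exact ((Finset.sum_eq_zero_iff_of_nonpos fun i _ => hy i).1 hS0 i (Finset.mem_univ i)).ge

theorem abs_sub_sum_le {y : Fin (n + 1) → ℝ} {t : ℝ}
    (h : (t - ∑ i, y i) ^ 2 ≤ 2 * ∑ k, peckerArgs y k) :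
    |t - ∑ i, y i| ≤ (1 - peckerConst (n + 1)) * |∑ i, y i| := by
  have hsq := sq_le_sq.1 (h.trans (two_mul_sum_peckerArgs_le y))
  rwa [abs_mul, abs_of_nonneg (sub_nonneg.2 (peckerConst_le_one _))] at hsq

theorem prod_mul_pow_le_prod_peckerArgs {y : Fin (n + 2) → ℝ} {μ : ℝ} (hμ : 0 ≤ μ)
    (hy : ∀ i, μ ≤ y i) : (∏ i, y i) * μ ^ n ≤ ∏ k, peckerArgs y k := by
  have hy0 : ∀ i, 0 ≤ y i := fun i => hμ.trans (hy i)
  have hfirst : ∑ j ∈ Finset.Iic (0 : Fin (n + 1)).castSucc, y j = y 0 := by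
    rw [Fin.castSucc_zero, show Finset.Iic (0 : Fin (n + 2)) = {0} from Finset.Iic_bot,
      Finset.sum_singleton]
  have hrest : μ ^ n ≤ ∏ k : Fin n, ∑ j ∈ Finset.Iic k.succ.castSucc, y j := by
    rw [← Fin.prod_const]
    exact Finset.prod_le_prod (fun _ _ => hμ) fun k _ => (hy k.succ.castSucc).trans
      (Finset.single_le_sum (fun i _ => hy0 i) (Finset.mem_Iic.2 le_rfl))
  calc (∏ i, y i) * μ ^ n = (∏ k : Fin (n + 1), y k.succ) * (y 0 * μ ^ n) := by
        rw [Fin.prod_univ_succ]; ring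
    _ ≤ (∏ k : Fin (n + 1), y k.succ) *
          (y 0 * ∏ k : Fin n, ∑ j ∈ Finset.Iic k.succ.castSucc, y j) := by
        have := Finset.prod_nonneg fun (k : Fin (n + 1)) (_ : k ∈ Finset.univ) => hy0 k.succ
        have := hy0 0
        gcongr
    _ = ∏ k, peckerArgs y k := by
        rw [← hfirst, ← Fin.prod_univ_succ fun k => ∑ j ∈ Finset.Iic k.castSucc, y j,
          ← Finset.prod_mul_distrib]
        rfl

theorem sq_le_peckerArgs {y : Fin (n + 1) → ℝ} {μ : ℝ} (hμ : 0 ≤ μ) (hy : ∀ i, μ ≤ y i)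
    (k : Fin n) : μ ^ 2 ≤ peckerArgs y k := by
  have hsum : μ ≤ ∑ j ∈ Finset.Iic k.castSucc, y j := (hy k.castSucc).trans
    (Finset.single_le_sum (fun i _ => hμ.trans (hy i)) (Finset.mem_Iic.2 le_rfl))
  rw [sq]
  exact mul_le_mul (hy k.succ) hsum hμ (hμ.trans (hy k.succ))

end PeckerArgs

section Pecker

variable {m : ℕ} {y : Fin (m + 1) → ℝ} {t : ℝ}

theorem nonneg_and_le_two_mul_sum_of_pecker_nonpos (ht : 0 ≤ t) (h : pecker m y t ≤ 0) :
    (∀ i, 0 ≤ y i) ∧ t ≤ 2 * ∑ i, y i := by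
  induction m generalizing t with
  | zero =>
    replace h : t ≤ y 0 := sub_nonpos.1 h
    rw [Fin.forall_fin_one, Fin.sum_univ_one]
    exact ⟨ht.trans h, by linarith⟩
  | succ m ih =>
    obtain ⟨hargs, hle⟩ := ih (sq_nonneg _) (pecker_succ y t ▸ h)
    have habs := abs_sub_sum_le hle
    have hy := nonneg_of_peckerArgs_nonneg ht hargs habs
    refine ⟨hy, ?_⟩
    have hS : 0 ≤ ∑ i, y i := Finset.sum_nonneg fun i _ => hy i
    rw [abs_of_nonneg hS] at habs
    nlinarith [le_abs_self (t - ∑ i, y i), peckerConst_pos (m + 1)]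

theorem peckerConst_mul_sum_le_of_pecker_nonpos (hm : m ≠ 0) (ht : 0 ≤ t) (h : pecker m y t ≤ 0) :
    peckerConst (m + 1) * ∑ i, y i ≤ t := by
  have hS : 0 ≤ ∑ i, y i :=
    Finset.sum_nonneg fun i _ => (nonneg_and_le_two_mul_sum_of_pecker_nonpos ht h).1 i
  obtain ⟨m, rfl⟩ := Nat.exists_eq_succ_of_ne_zero hm
  have habs := abs_sub_sum_le
    (nonneg_and_le_two_mul_sum_of_pecker_nonpos (sq_nonneg _) (pecker_succ y t ▸ h)).2
  rw [abs_of_nonneg hS] at habs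
  linarith [neg_abs_le (t - ∑ i, y i)]

theorem exists_pecker_le {μ : ℝ} (hμ : 0 ≤ μ) (hy : ∀ i, μ ≤ y i) :
    ∃ t, 0 ≤ t ∧ (m ≠ 0 → ∑ i, y i ≤ t) ∧
      pecker m y t ≤ -((∏ i, y i) * μ ^ (2 ^ m - (m + 1))) := by
  induction m generalizing μ with
  | zero => exact ⟨0, le_rfl, by simp, by simp [pecker]⟩
  | succ m ih =>
    obtain ⟨u, hu, -, hpecker⟩ := ih (sq_nonneg μ) (sq_le_peckerArgs hμ hy)
    have hS : 0 ≤ ∑ i, y i := Finset.sum_nonneg fun i _ => hμ.trans (hy i)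
    have hexp : 2 ^ (m + 1) - (m + 2) = m + 2 * (2 ^ m - (m + 1)) := by
      have : m < 2 ^ m := Nat.lt_two_pow_self
      rw [pow_succ]
      omega
    refine ⟨∑ i, y i + √u, by positivity, fun _ => le_add_of_nonneg_right (Real.sqrt_nonneg u), ?_⟩
    rw [pecker_succ, add_sub_cancel_left, Real.sq_sqrt hu]
    refine hpecker.trans (neg_le_neg ?_)
    rw [hexp, pow_add, ← mul_assoc, pow_mul]
    gcongr
    exact prod_mul_pow_le_prod_peckerArgs hμ hy

end Pecker

theorem peckerExp_succ (m : ℕ) :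
    peckerExp (m + 1) = 2 ^ m + 2 ^ m + m * (2 ^ m - (m + 1)) := by
  obtain ⟨c, hc⟩ : ∃ c, 2 ^ m = m + 1 + c := Nat.exists_eq_add_of_le Nat.lt_two_pow_self
  rw [peckerExp, Nat.add_sub_cancel, hc, Nat.add_sub_cancel_left]
  exact Nat.sub_eq_of_eq_add (by ring)

section ModPecker

/-- The tuple `(a_1, …, a_m, 1 / (a_1 ⋯ a_m))`, whose entries have product `1`: up to positive
factors, `Q_{m+1}(a_1, …, a_m, 1, t)` is the value of `P_{m+1}` at this tuple. -/
noncomputable def snocInvProd {m : ℕ} (a : Fin m → ℝ) : Fin (m + 1) → ℝ :=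
  Fin.snoc (α := fun _ => ℝ) a (1 / ∏ i, a i)

variable {m : ℕ} {a : Fin m → ℝ} {t : ℝ}

theorem prod_snoc_one {M : Type*} [CommMonoid M] (a : Fin m → M) :
    ∏ i, (Fin.snoc (α := fun _ => M) a 1 : Fin (m + 1) → M) i = ∏ i, a i := by
  simp [Fin.prod_univ_castSucc]

theorem prod_snocInvProd (ha : ∏ i, a i ≠ 0) : ∏ i, snocInvProd a i = 1 := by
  simp [snocInvProd, Fin.prod_univ_castSucc, ha]

theorem snocInvProd_pos (ha : ∀ i, 0 < a i) (i : Fin (m + 1)) : 0 < snocInvProd a i := by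
  refine Fin.lastCases ?_ (fun i => ?_) i
  · simpa [snocInvProd] using Finset.prod_pos fun i _ => ha i
  · simpa [snocInvProd] using ha i

theorem one_le_sum_snocInvProd (ha : ∀ i, 0 < a i) : 1 ≤ ∑ i, snocInvProd a i :=
  one_le_sum_of_prod_eq_one (fun i => (snocInvProd_pos ha i).le)
    (prod_snocInvProd (Finset.prod_pos fun i _ => ha i).ne')

theorem modPecker_snoc_one (a : Fin m → ℝ) (t : ℝ) :
    modPecker m (Fin.snoc (α := fun _ => ℝ) a 1) t =
      (t / peckerConst (m + 1) + 1) ^ peckerExp (m + 1) *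
        pecker m (Fin.snoc (α := fun _ => ℝ) (fun i => (∏ j, a j) * a i) 1) ((∏ j, a j) * t) := by
  simp only [modPecker, prod_snoc_one, Fin.snoc_last, Fin.snoc_castSucc]

theorem modPecker_snoc_one_of_ne_zero (ha : ∏ i, a i ≠ 0) (t : ℝ) :
    modPecker m (Fin.snoc (α := fun _ => ℝ) a 1) t =
      (t / peckerConst (m + 1) + 1) ^ peckerExp (m + 1) * (∏ i, a i) ^ 2 ^ m *
        pecker m (snocInvProd a) t := by
  rw [modPecker_eq _ _ _ (by rwa [prod_snoc_one]), prod_snoc_one]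
  simp only [Fin.snoc_last, Fin.snoc_castSucc, snocInvProd]

theorem prod_pos_of_modPecker_nonpos (hm : m ≠ 0) (ht : 0 ≤ t)
    (h : modPecker m (Fin.snoc (α := fun _ => ℝ) a 1) t ≤ 0) : 0 < ∏ i, a i := by
  set w := ∏ i, a i
  set y : Fin (m + 1) → ℝ := Fin.snoc (α := fun _ => ℝ) (fun i => w * a i) 1 with hy
  have hlast : y (Fin.last m) = 1 := Fin.snoc_last ..
  have hC := peckerConst_pos m
  have hpecker : pecker m y (w * t) ≤ 0 := by
    rw [modPecker_snoc_one] at h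
    exact nonpos_of_mul_nonpos_right h (by positivity)
  by_contra! hle
  obtain hneg | hzero := hle.lt_or_eq
  · -- `P_{m+1}` has even degree, so the signs of `y` and of `w t` can be changed together.
    have hneg_args : pecker m (fun i => -1 * y i) (-1 * (w * t)) ≤ 0 := by
      rwa [pecker_smul, (even_two.pow_of_ne_zero hm).neg_one_pow, one_mul]
    have hwt : 0 ≤ -1 * (w * t) := by linarith [mul_nonpos_of_nonpos_of_nonneg hneg.le ht]
    linarith [(nonneg_and_le_two_mul_sum_of_pecker_nonpos hwt hneg_args).1 (Fin.last m)]
  · have hsum : ∑ i, y i = 1 := by simp [hy, hzero, Fin.sum_univ_castSucc]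
    have := peckerConst_mul_sum_le_of_pecker_nonpos hm (by rw [hzero, zero_mul]) hpecker
    rw [hsum, hzero] at this
    linarith

theorem pecker_snocInvProd_nonpos_of_modPecker_nonpos (hm : m ≠ 0) (ht : 0 ≤ t)
    (h : modPecker m (Fin.snoc (α := fun _ => ℝ) a 1) t ≤ 0) : pecker m (snocInvProd a) t ≤ 0 := by
  have hw := prod_pos_of_modPecker_nonpos hm ht h
  have hC := peckerConst_pos m
  rw [modPecker_snoc_one_of_ne_zero hw.ne'] at h
  exact nonpos_of_mul_nonpos_right h (by positivity)

theorem pos_of_modPecker_nonpos (hm : m ≠ 0) (ht : 0 ≤ t)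
    (h : modPecker m (Fin.snoc (α := fun _ => ℝ) a 1) t ≤ 0) (i : Fin m) : 0 < a i := by
  have hi := (nonneg_and_le_two_mul_sum_of_pecker_nonpos ht
    (pecker_snocInvProd_nonpos_of_modPecker_nonpos hm ht h)).1 i.castSucc
  rw [snocInvProd, Fin.snoc_castSucc] at hi
  exact hi.lt_of_ne' (Finset.prod_ne_zero_iff.1 (prod_pos_of_modPecker_nonpos hm ht h).ne' i
    (Finset.mem_univ i))

theorem peckerConst_le_of_modPecker_nonpos (hm : m ≠ 0) (ht : 0 ≤ t)
    (h : modPecker m (Fin.snoc (α := fun _ => ℝ) a 1) t ≤ 0) : peckerConst (m + 1) ≤ t :=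
  calc peckerConst (m + 1) ≤ peckerConst (m + 1) * ∑ i, snocInvProd a i :=
        le_mul_of_one_le_right (peckerConst_pos m).le
          (one_le_sum_snocInvProd (pos_of_modPecker_nonpos hm ht h))
    _ ≤ t := peckerConst_mul_sum_le_of_pecker_nonpos hm ht
        (pecker_snocInvProd_nonpos_of_modPecker_nonpos hm ht h)

theorem eventually_modPecker_pos (hm : m ≠ 0) (a : Fin m → ℝ) :
    ∀ᶠ t in atTop, 0 < modPecker m (Fin.snoc (α := fun _ => ℝ) a 1) t := by
  filter_upwards [eventually_ge_atTop 0, eventually_gt_atTop (2 * ∑ i, snocInvProd a i)]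
    with t ht hlt
  by_contra! h
  exact hlt.not_ge (nonneg_and_le_two_mul_sum_of_pecker_nonpos ht
    (pecker_snocInvProd_nonpos_of_modPecker_nonpos hm ht h)).2

/-- This is the estimate that dictates the exponent `ℓ(m + 1)`. -/
theorem one_le_pow_peckerExp_mul (m : ℕ) {T U w : ℝ} (hU : 1 ≤ U) (hUT : U ≤ T) (hw : 0 ≤ w)
    (hwU : 1 ≤ w * U) :
    1 ≤ T ^ peckerExp (m + 1) * w ^ 2 ^ m * (U ^ m)⁻¹ ^ (2 ^ m - (m + 1)) :=
  calc (1 : ℝ) ≤ (w * U) ^ 2 ^ m * U ^ 2 ^ m :=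
        one_le_mul_of_one_le_of_one_le (one_le_pow₀ hwU) (one_le_pow₀ hU)
    _ = U ^ peckerExp (m + 1) * w ^ 2 ^ m * (U ^ m)⁻¹ ^ (2 ^ m - (m + 1)) := by
        rw [peckerExp_succ, pow_add, pow_add, pow_mul, mul_pow, inv_pow]
        field_simp
    _ ≤ T ^ peckerExp (m + 1) * w ^ 2 ^ m * (U ^ m)⁻¹ ^ (2 ^ m - (m + 1)) := by gcongr

theorem exists_modPecker_le_neg_one (hm : m ≠ 0) (ha : ∀ i, 0 < a i) :
    ∃ t, 0 < t ∧ modPecker m (Fin.snoc (α := fun _ => ℝ) a 1) t ≤ -1 := by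
  have hw : 0 < ∏ i, a i := Finset.prod_pos fun i _ => ha i
  have hprod := prod_snocInvProd hw.ne'
  have hpos := snocInvProd_pos ha
  have hU := one_le_sum_snocInvProd ha
  have hC := peckerConst_pos m
  set U := ∑ i, snocInvProd a i
  have hwU : 1 ≤ (∏ i, a i) * U := by
    have hlast : snocInvProd a (Fin.last m) ≤ U :=
      Finset.single_le_sum (fun i _ => (hpos i).le) (Finset.mem_univ _)
    rwa [snocInvProd, Fin.snoc_last, div_le_iff₀' hw] at hlast
  obtain ⟨t, -, hUt, hpecker⟩ := exists_pecker_le (by positivity)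
    (inv_sum_pow_le_of_prod_eq_one hpos hprod)
  rw [hprod, one_mul, Fintype.card_fin, Nat.add_sub_cancel] at hpecker
  have ht : 0 < t := by linarith [hUt hm]
  have hUT : U ≤ t / peckerConst (m + 1) + 1 := by
    linarith [hUt hm, le_div_self ht.le hC (peckerConst_le_one _)]
  refine ⟨t, ht, ?_⟩
  rw [modPecker_snoc_one_of_ne_zero hw.ne']
  calc _ ≤ (t / peckerConst (m + 1) + 1) ^ peckerExp (m + 1) * (∏ i, a i) ^ 2 ^ m *
        -(U ^ m)⁻¹ ^ (2 ^ m - (m + 1)) := by gcongr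
    _ ≤ -1 := by linarith [one_le_pow_peckerExp_mul m hU hUT hw.le hwU]

end ModPecker

section Point

variable {N : ℕ}

@[simp]
theorem base_point (x' : EuclideanSpace ℝ (Fin N)) (t : ℝ) : base (point x' t) = x' := by
  ext i
  simp [base, point]

@[simp]
theorem point_last (x' : EuclideanSpace ℝ (Fin N)) (t : ℝ) : point x' t (Fin.last N) = t := by
  simp [point]

@[simp]
theorem point_base_last (x : EuclideanSpace ℝ (Fin (N + 1))) :
    point (base x) (x (Fin.last N)) = x := by
  ext i
  refine Fin.lastCases ?_ (fun i => ?_) i <;> simp [point, base]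

theorem point_add_smul_en (x' : EuclideanSpace ℝ (Fin N)) (s c : ℝ) :
    point x' s + c • en N = point x' (s + c) := by
  ext i
  refine Fin.lastCases ?_ (fun i => ?_) i <;> simp [point, en]

theorem continuous_ev_point (p : MvPolynomial (Fin (N + 1)) ℝ) (x' : EuclideanSpace ℝ (Fin N)) :
    Continuous fun t : ℝ => ev p (point x' t) := by
  refine (MvPolynomial.continuous_eval p).comp (continuous_pi fun i => ?_)
  refine Fin.lastCases ?_ (fun i => ?_) i
  · simpa [point] using continuous_id'
  · simpa [point] using continuous_const

end Point

section PolQ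

variable {N m : ℕ} {g : Fin m → MvPolynomial (Fin N) ℝ} {G : MvPolynomial (Fin N) ℝ}

theorem modPecker_nonpos_of_polQ_nonpos {x : EuclideanSpace ℝ (Fin (N + 1))}
    (hG : 0 < ev G (base x)) (h : ev (polQ g G) x ≤ 0) :
    modPecker m (Fin.snoc (α := fun _ => ℝ) (fun i => ev (g i) (base x)) 1)
      (x (Fin.last N) ^ 2 * peckerConst (m + 1) / ev G (base x) ^ 2) ≤ 0 := by
  rw [eval_polQ _ _ _ hG.ne'] at h
  exact nonpos_of_mul_nonpos_right h (by positivity)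

theorem pos_of_polQ_nonpos (hm : m ≠ 0) {x : EuclideanSpace ℝ (Fin (N + 1))}
    (hG : 0 < ev G (base x)) (h : ev (polQ g G) x ≤ 0) (i : Fin m) : 0 < ev (g i) (base x) := by
  have hC := peckerConst_pos m
  exact pos_of_modPecker_nonpos hm (by positivity) (modPecker_nonpos_of_polQ_nonpos hG h) i

theorem le_last_of_polQ_nonpos (hm : m ≠ 0) {x : EuclideanSpace ℝ (Fin (N + 1))}
    (hx : 0 ≤ x (Fin.last N)) (hG : 0 < ev G (base x)) (h : ev (polQ g G) x ≤ 0) :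
    ev G (base x) ≤ x (Fin.last N) := by
  have hC := peckerConst_pos m
  have hle := peckerConst_le_of_modPecker_nonpos hm (by positivity)
    (modPecker_nonpos_of_polQ_nonpos hG h)
  rw [le_div_iff₀ (by positivity), mul_comm] at hle
  exact le_of_sq_le_sq (le_of_mul_le_mul_right hle hC) hx

theorem eventually_polQ_pos (hm : m ≠ 0) (g : Fin m → MvPolynomial (Fin N) ℝ)
    {x' : EuclideanSpace ℝ (Fin N)} (hG : 0 < ev G x') :
    ∀ᶠ t : ℝ in atTop, 0 < ev (polQ g G) (point x' t) := by
  have hC := peckerConst_pos m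
  have hatTop : Tendsto (fun t : ℝ => t ^ 2 * peckerConst (m + 1) / ev G x' ^ 2) atTop atTop :=
    ((tendsto_pow_atTop two_ne_zero).atTop_mul_const hC).atTop_div_const (by positivity)
  filter_upwards [hatTop.eventually (eventually_modPecker_pos hm fun i => ev (g i) x')] with t ht
  rw [eval_polQ _ _ _ (by simpa using hG.ne'), base_point, point_last]
  positivity

theorem exists_polQ_le_neg_one (hm : m ≠ 0) {x' : EuclideanSpace ℝ (Fin N)}
    (hG : 1 ≤ ev G x') (hg : ∀ i, 0 < ev (g i) x') :
    ∃ s, 0 < s ∧ ev (polQ g G) (point x' s) ≤ -1 := by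
  obtain ⟨t, ht, hQ⟩ := exists_modPecker_le_neg_one hm hg
  have hG0 : 0 < ev G x' := by linarith
  have hC := peckerConst_pos m
  refine ⟨ev G x' * √(t / peckerConst (m + 1)), by positivity, ?_⟩
  have harg : (ev G x' * √(t / peckerConst (m + 1))) ^ 2 * peckerConst (m + 1) / ev G x' ^ 2 =
      t := by
    rw [mul_pow, Real.sq_sqrt (by positivity)]
    field_simp
  rw [eval_polQ _ _ _ (by simpa using hG0.ne'), base_point, point_last, harg]
  nlinarith [one_le_pow₀ hG (n := 2 * peckerExp (m + 1) + 2 ^ (m + 1))]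

end PolQ

section Cone

variable {N m : ℕ} {δ : ℝ}

theorem mem_coneOver {T : Set (EuclideanSpace ℝ (Fin (N + 1)))}
    {p : EuclideanSpace ℝ (Fin (N + 1))} :
    p ∈ coneOver δ T ↔ ∃ x ∈ T, ‖base p - base x‖ ≤ δ * (p (Fin.last N) - x (Fin.last N)) := by
  have hsub : ∀ x, p - x ∈ verticalCone δ ↔
      ‖base p - base x‖ ≤ δ * (p (Fin.last N) - x (Fin.last N)) := fun x => Iff.rfl
  simp only [coneOver, Set.mem_add, ← hsub]
  constructor
  · rintro ⟨x, hx, v, hv, rfl⟩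
    exact ⟨x, hx, by rwa [add_sub_cancel_left]⟩
  · rintro ⟨x, hx, hv⟩
    exact ⟨x, hx, p - x, hv, add_sub_cancel x p⟩

theorem coneOver_mono {T T' : Set (EuclideanSpace ℝ (Fin (N + 1)))} (h : T ⊆ T') :
    coneOver δ T ⊆ coneOver δ T' :=
  Set.add_subset_add_right h

theorem mem_setS {g : Fin m → MvPolynomial (Fin N) ℝ} {G : MvPolynomial (Fin N) ℝ}
    {x : EuclideanSpace ℝ (Fin (N + 1))} :
    x ∈ setS g G ↔
      ∃ s, 0 < s ∧ s ≤ x (Fin.last N) ∧ ev (polQ g G) (point (base x) s) ≤ 0 := by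
  constructor
  · rintro ⟨u, ⟨hQ, hu⟩, c, hc, rfl⟩
    obtain ⟨u', s, rfl⟩ : ∃ u' s, u = point u' s := ⟨_, _, (point_base_last u).symm⟩
    rw [point_last] at hu
    rw [point_add_smul_en, base_point, point_last]
    exact ⟨s, hu, le_add_of_nonneg_right hc, hQ⟩
  · rintro ⟨s, hs, hsx, hQ⟩
    refine ⟨point (base x) s, ⟨hQ, by rwa [point_last]⟩, _, sub_nonneg.2 hsx, ?_⟩
    rw [point_add_smul_en, add_sub_cancel, point_base_last]

end Cone

section Factors

variable {n N : ℕ}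

theorem ev_polA (P Q : MvPolynomial (Fin n) ℝ) (x : EuclideanSpace ℝ (Fin n)) :
    ev (polA P Q) x = (1 + ev P x ^ 2 * ev Q x) ^ 2 := by
  simp [ev, polA]

theorem ev_polB (P Q : MvPolynomial (Fin n) ℝ) (k : ℕ) (x : EuclideanSpace ℝ (Fin n)) :
    ev (polB P Q k) x = (ev (polA P Q) x + ev (polA P Q) x ^ k) / 2 := by
  simp only [ev, polB, map_mul, map_add, map_pow, MvPolynomial.eval_C]
  ring

theorem ev_polA_nonneg (P Q : MvPolynomial (Fin n) ℝ) (x : EuclideanSpace ℝ (Fin n)) :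
    0 ≤ ev (polA P Q) x := by
  rw [ev_polA]
  positivity

theorem one_le_ev_polA (P : MvPolynomial (Fin n) ℝ) {Q : MvPolynomial (Fin n) ℝ}
    {x : EuclideanSpace ℝ (Fin n)} (hQ : 0 ≤ ev Q x) : 1 ≤ ev (polA P Q) x := by
  rw [ev_polA]
  exact one_le_pow₀ (le_add_of_nonneg_right (by positivity))

theorem tendsto_ev_polB_mul_atTop (P : MvPolynomial (Fin (N + 1)) ℝ)
    {Q : MvPolynomial (Fin (N + 1)) ℝ} (k : ℕ) {x' : EuclideanSpace ℝ (Fin N)}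
    (hQ : ∀ᶠ t in atTop, 0 ≤ ev Q (point x' t)) :
    Tendsto (fun t => ev (polB P Q k) (point x' t) * t) atTop atTop := by
  refine tendsto_atTop_mono' atTop ?_ tendsto_id
  filter_upwards [hQ, eventually_ge_atTop 0] with t hQt ht
  have hA := one_le_ev_polA P hQt
  have hB : 1 ≤ ev (polB P Q k) (point x' t) := by
    rw [ev_polB]
    linarith [one_le_pow₀ hA (n := k)]
  exact le_mul_of_one_le_left ht hB

theorem exists_ev_polA_eq_zero {P Q : MvPolynomial (Fin (N + 1)) ℝ}
    {x' : EuclideanSpace ℝ (Fin N)} {s : ℝ} (hP : 1 ≤ ev P (point x' s))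
    (hQs : ev Q (point x' s) ≤ -1) (hQ : ∀ᶠ t in atTop, 0 ≤ ev Q (point x' t)) :
    ∃ t, s ≤ t ∧ ev (polA P Q) (point x' t) = 0 := by
  obtain ⟨T, hQT, hsT⟩ := (hQ.and (eventually_ge_atTop s)).exists
  set φ : ℝ → ℝ := fun t => 1 + ev P (point x' t) ^ 2 * ev Q (point x' t)
  have hφ : Continuous φ := continuous_const.add
    (((continuous_ev_point P x').pow 2).mul (continuous_ev_point Q x'))
  have hφs : φ s ≤ 0 := by
    have := one_le_pow₀ hP (n := 2)
    dsimp only [φ]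
    nlinarith
  have hφT : 0 ≤ φ T := by
    dsimp only [φ]
    positivity
  obtain ⟨t, ⟨hst, -⟩, ht⟩ := intermediate_value_Icc hsT hφ.continuousOn ⟨hφs, hφT⟩
  exact ⟨t, hst, by rw [ev_polA]; exact (sq_eq_zero_iff).2 ht⟩

theorem exists_ev_polB_mul_eq {P Q : MvPolynomial (Fin (N + 1)) ℝ} {k : ℕ} (hk : k ≠ 0)
    {x' : EuclideanSpace ℝ (Fin N)} {t₀ : ℝ} (hA : ev (polA P Q) (point x' t₀) = 0)
    (hQ : ∀ᶠ t in atTop, 0 ≤ ev Q (point x' t)) {c : ℝ} (hc : 0 ≤ c) :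
    ∃ t, t₀ ≤ t ∧ ev (polB P Q k) (point x' t) * t = c := by
  obtain ⟨T, hcT, hT⟩ := (((tendsto_ev_polB_mul_atTop P k hQ).eventually_ge_atTop c).and
    (eventually_ge_atTop t₀)).exists
  have hcont : Continuous fun t => ev (polB P Q k) (point x' t) * t :=
    (continuous_ev_point _ x').mul continuous_id
  have hzero : ev (polB P Q k) (point x' t₀) * t₀ = 0 := by
    rw [ev_polB, hA, zero_pow hk, add_zero, zero_div, zero_mul]
  obtain ⟨t, ⟨ht, -⟩, htc⟩ := intermediate_value_Icc hT hcont.continuousOn ⟨hzero.trans_le hc, hcT⟩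
  exact ⟨t, ht, htc⟩

theorem exists_mem_setS_ev_polB_mul_eq {m : ℕ} (hm : m ≠ 0) {g : Fin m → MvPolynomial (Fin N) ℝ}
    {G : MvPolynomial (Fin N) ℝ} {P : MvPolynomial (Fin (N + 1)) ℝ} {k : ℕ} (hk : k ≠ 0)
    {x' : EuclideanSpace ℝ (Fin N)} (hG : 1 ≤ ev G x') (hg : ∀ i, 0 < ev (g i) x')
    (hP : ∀ x ∈ setS g G, 1 ≤ ev P x) {c : ℝ} (hc : 0 ≤ c) :
    ∃ t, point x' t ∈ setS g G ∧ ev (polB P (polQ g G) k) (point x' t) * t = c := by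
  obtain ⟨s, hs, hQs⟩ := exists_polQ_le_neg_one hm hG hg
  have hS : ∀ t, s ≤ t → point x' t ∈ setS g G := fun t ht => by
    rw [mem_setS, base_point, point_last]
    exact ⟨s, hs, ht, by linarith⟩
  have hQ : ∀ᶠ t in atTop, 0 ≤ ev (polQ g G) (point x' t) :=
    (eventually_polQ_pos hm g (one_pos.trans_le hG)).mono fun _ => le_of_lt
  obtain ⟨t₀, hst₀, hA⟩ := exists_ev_polA_eq_zero (hP _ (hS s le_rfl)) hQs hQ
  obtain ⟨t, ht₀t, ht⟩ := exists_ev_polB_mul_eq hk hA hQ hc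
  exact ⟨t, hS t (hst₀.trans ht₀t), ht⟩

end Factors

section Parts

theorem norm_le_sqrt_card_mul {ι : Type*} [Fintype ι] {v : EuclideanSpace ℝ ι} {ε : ℝ}
    (hε : 0 ≤ ε) (hv : ∀ i, |v i| ≤ ε) : ‖v‖ ≤ √(Fintype.card ι) * ε := by
  refine le_of_sq_le_sq ?_ (by positivity)
  rw [EuclideanSpace.real_norm_sq_eq, mul_pow, Real.sq_sqrt (by positivity)]
  calc ∑ i, v i ^ 2 ≤ ∑ _i : ι, ε ^ 2 :=
        Finset.sum_le_sum fun i _ => sq_le_sq.2 ((hv i).trans (le_abs_self ε))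
    _ = Fintype.card ι * ε ^ 2 := by rw [Finset.sum_const, Finset.card_univ, nsmul_eq_mul]

variable {d q : ℕ}

/-- The block `y` of `x = (y, z, x_n)`. -/
noncomputable def yPart (x : EuclideanSpace ℝ (Fin (d + q + 1))) : EuclideanSpace ℝ (Fin d) :=
  WithLp.toLp 2 fun i => base x (Fin.castAdd q i)

/-- The block `z` of `x = (y, z, x_n)`. -/
noncomputable def zPart (x : EuclideanSpace ℝ (Fin (d + q + 1))) : EuclideanSpace ℝ (Fin q) :=
  WithLp.toLp 2 fun j => base x (Fin.natAdd d j)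

/-- The projection `(y, 0, 0)` of `x = (y, z, x_n)`, which is the point of `D` whose cone contains
`x` when `x ∈ S`. -/
noncomputable def foot (x : EuclideanSpace ℝ (Fin (d + q + 1))) :
    EuclideanSpace ℝ (Fin (d + q + 1)) :=
  point (WithLp.toLp 2 (Fin.append (yPart x) 0)) 0

variable {x p : EuclideanSpace ℝ (Fin (d + q + 1))} {δ : ℝ}

theorem yPart_foot (x : EuclideanSpace ℝ (Fin (d + q + 1))) : yPart (foot x) = yPart x := by
  ext i
  simp [yPart, foot]

theorem zPart_foot (x : EuclideanSpace ℝ (Fin (d + q + 1))) : zPart (foot x) = 0 := by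
  ext j
  simp [zPart, foot]

theorem foot_last (x : EuclideanSpace ℝ (Fin (d + q + 1))) : foot x (Fin.last _) = 0 :=
  point_last _ _

theorem eq_of_parts_eq (hy : yPart p = yPart x) (hz : zPart p = zPart x)
    (hlast : p (Fin.last _) = x (Fin.last _)) : p = x := by
  ext i
  refine Fin.lastCases hlast (fun i => Fin.addCases (fun i => ?_) (fun j => ?_) i) i
  · exact congrArg (· i) hy
  · exact congrArg (· j) hz

theorem yPart_point_base (x : EuclideanSpace ℝ (Fin (d + q + 1))) (t : ℝ) :
    yPart (point (base x) t) = yPart x := by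
  rw [yPart, base_point, yPart]

theorem zPart_point_base (x : EuclideanSpace ℝ (Fin (d + q + 1))) (t : ℝ) :
    zPart (point (base x) t) = zPart x := by
  rw [zPart, base_point, zPart]

theorem norm_base_sub_sq (x p : EuclideanSpace ℝ (Fin (d + q + 1))) :
    ‖base p - base x‖ ^ 2 = ‖yPart p - yPart x‖ ^ 2 + ‖zPart p - zPart x‖ ^ 2 := by
  simp only [EuclideanSpace.real_norm_sq_eq, Fin.sum_univ_add]
  rfl

theorem norm_zPart_sub_le_norm_base_sub (x p : EuclideanSpace ℝ (Fin (d + q + 1))) :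
    ‖zPart p - zPart x‖ ≤ ‖base p - base x‖ := by
  refine le_of_sq_le_sq ?_ (norm_nonneg _)
  rw [norm_base_sub_sq]
  exact le_add_of_nonneg_left (sq_nonneg _)

theorem norm_base_sub_eq_of_yPart_eq (hy : yPart p = yPart x) :
    ‖base p - base x‖ = ‖zPart p - zPart x‖ := by
  rw [← sq_eq_sq₀ (norm_nonneg _) (norm_nonneg _), norm_base_sub_sq, hy, sub_self, norm_zero]
  ring

theorem mem_coneOver_singleton_of_yPart_eq (hy : yPart p = yPart x) :
    p ∈ coneOver δ {x} ↔
      ‖zPart p - zPart x‖ ≤ δ * (p (Fin.last _) - x (Fin.last _)) := by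
  simp only [mem_coneOver, Set.mem_singleton_iff, exists_eq_left, norm_base_sub_eq_of_yPart_eq hy]

theorem mem_coneOver_foot : x ∈ coneOver δ {foot x} ↔ ‖zPart x‖ ≤ δ * x (Fin.last _) := by
  rw [mem_coneOver_singleton_of_yPart_eq (yPart_foot x).symm, zPart_foot, foot_last, sub_zero,
    sub_zero]

end Parts

section ConeMap

variable {d q : ℕ} (P Q : MvPolynomial (Fin (d + q + 1)) ℝ) (k : ℕ)
  (x : EuclideanSpace ℝ (Fin (d + q + 1)))

theorem yPart_coneMap : yPart (coneMap P Q k x) = yPart x := by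
  ext i
  simp only [yPart, base, coneMap, polyMap, ev, Fin.snoc_castSucc, Fin.append_left,
    MvPolynomial.eval_X]

theorem zPart_coneMap : zPart (coneMap P Q k x) = ev (polA P Q) x • zPart x := by
  ext j
  simp only [zPart, base, coneMap, polyMap, ev, Fin.snoc_castSucc, Fin.append_right, map_mul,
    MvPolynomial.eval_X, PiLp.smul_apply, smul_eq_mul]

theorem coneMap_last : coneMap P Q k x (Fin.last _) = ev (polB P Q k) x * x (Fin.last _) := by
  simp [coneMap, polyMap, ev]

theorem foot_coneMap : foot (coneMap P Q k x) = foot x := by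
  rw [foot, yPart_coneMap, foot]

variable {P Q k x} {δ Δ : ℝ}

theorem coneMap_mem_coneOver_foot (hx : x ∈ coneOver δ {foot x}) :
    coneMap P Q k x ∈ coneOver (2 * δ) {foot x} := by
  have hA := ev_polA_nonneg P Q x
  rw [mem_coneOver_foot] at hx
  have hpos : 0 ≤ ev (polA P Q) x ^ k * (δ * x (Fin.last _)) :=
    mul_nonneg (pow_nonneg hA k) ((norm_nonneg _).trans hx)
  rw [← foot_coneMap P Q k, mem_coneOver_foot, zPart_coneMap, coneMap_last, norm_smul,
    Real.norm_of_nonneg hA, ev_polB]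
  calc ev (polA P Q) x * ‖zPart x‖ ≤ ev (polA P Q) x * (δ * x (Fin.last _)) := by gcongr
    _ ≤ ev (polA P Q) x * (δ * x (Fin.last _)) + ev (polA P Q) x ^ k * (δ * x (Fin.last _)) :=
        le_add_of_nonneg_right hpos
    _ = 2 * δ * ((ev (polA P Q) x + ev (polA P Q) x ^ k) / 2 * x (Fin.last _)) := by ring

theorem coneMap_mem_coneOver_self (hδ : 0 ≤ δ) (hk : Δ ≤ k * δ) (hx : 0 ≤ x (Fin.last _))
    (hQ : 0 ≤ ev Q x) (hz : ‖zPart x‖ ≤ Δ * x (Fin.last _)) :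
    coneMap P Q k x ∈ coneOver (2 * δ) {x} := by
  rw [mem_coneOver_singleton_of_yPart_eq (yPart_coneMap P Q k x), zPart_coneMap, coneMap_last,
    ev_polB]
  have hA := one_le_ev_polA P hQ
  set A := ev (polA P Q) x
  set s := x (Fin.last _)
  have hA1 : 0 ≤ A - 1 := sub_nonneg.2 hA
  have hbernoulli : k * (A - 1) ≤ A ^ k - 1 := by
    have := one_add_mul_le_pow (by linarith : -2 ≤ A - 1) k
    rw [add_sub_cancel] at this
    linarith
  calc ‖A • zPart x - zPart x‖ = (A - 1) * ‖zPart x‖ := by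
        rw [← Real.norm_of_nonneg hA1, ← norm_smul, sub_smul, one_smul]
    _ ≤ (A - 1) * (k * δ * s) := by gcongr; exact hz.trans (by gcongr)
    _ = δ * s * (k * (A - 1)) := by ring
    _ ≤ δ * s * (A ^ k - 1) := by gcongr
    _ ≤ δ * s * (A - 1 + (A ^ k - 1)) := by gcongr; exact le_add_of_nonneg_left hA1
    _ = 2 * δ * ((A + A ^ k) / 2 * s - s) := by ring

end ConeMap

section Thicken

variable {d q r : ℕ} {g : Fin r → MvPolynomial (Fin d) ℝ} {G : MvPolynomial (Fin (d + q)) ℝ}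
  {P : MvPolynomial (Fin (d + q + 1)) ℝ} {ε δ Δ : ℝ} {x : EuclideanSpace ℝ (Fin (d + q + 1))}

theorem thicken_pos_iff :
    (∀ i, 0 < ev (thicken g ε i) (base x)) ↔
      (∀ i, 0 < ev (g i) (yPart x)) ∧ ∀ j, |zPart x j| < ε := by
  have hy : ∀ i, ev (thicken g ε ((Fin.castAdd q i).castAdd q)) (base x) = ev (g i) (yPart x) := by
    intro i
    simp only [thicken, Fin.append_left, ev, MvPolynomial.eval_rename]
    rfl
  have hlower : ∀ j, ev (thicken g ε ((Fin.natAdd r j).castAdd q)) (base x) = zPart x j + ε := by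
    simp [thicken, ev, base, zPart]
  have hupper : ∀ j, ev (thicken g ε (Fin.natAdd (r + q) j)) (base x) = ε - zPart x j := by
    simp [thicken, ev, base, zPart]
  simp only [Fin.forall_fin_add, hy, hlower, hupper, abs_lt, forall_and, and_assoc, sub_pos,
    neg_lt_iff_pos_add]

theorem mem_setD (hε : 0 < ε) :
    x ∈ setD g ε ↔ (∀ i, 0 < ev (g i) (yPart x)) ∧ zPart x = 0 ∧ x (Fin.last _) = 0 := by
  have hz : zPart x = 0 ↔ ∀ j : Fin q, x (Fin.natAdd d j).castSucc = 0 := PiLp.ext_iff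
  simp only [setD, setA, Set.mem_inter_iff, Set.mem_ofPred_eq, thicken_pos_iff, ← hz]
  refine ⟨fun ⟨⟨⟨hg, _⟩, _⟩, h⟩ => ⟨hg, h⟩, fun ⟨hg, h⟩ => ⟨⟨⟨hg, fun j => ?_⟩, h.2⟩, h⟩⟩
  simpa [h.1] using hε

theorem foot_mem_setD (hε : 0 < ε) (hg : ∀ i, 0 < ev (g i) (yPart x)) :
    foot x ∈ setD (q := q) g ε := by
  rw [mem_setD hε, yPart_foot]
  exact ⟨hg, zPart_foot x, foot_last x⟩

theorem norm_zPart_le_of_mem_coneOver_setD (hε : 0 < ε) (hx : x ∈ coneOver Δ (setD g ε)) :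
    ‖zPart x‖ ≤ Δ * x (Fin.last _) := by
  obtain ⟨u, hu, hle⟩ := mem_coneOver.1 hx
  obtain ⟨-, huz, hulast⟩ := (mem_setD hε).1 hu
  have := (norm_zPart_sub_le_norm_base_sub u x).trans hle
  rwa [huz, hulast, sub_zero, sub_zero] at this

theorem foot_mem_setD_and_mem_coneOver_foot (hq : q ≠ 0) (hε : 0 < ε) (hδ : 0 < δ)
    (hG : ∀ x', ε * (√q / δ) ≤ ev G x') (hx : x ∈ setS (thicken g ε) G) :
    foot x ∈ setD g ε ∧ x ∈ coneOver δ {foot x} := by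
  obtain ⟨s, hs, hsx, hQ⟩ := mem_setS.1 hx
  have hm : r + q + q ≠ 0 := by omega
  have hG0 : 0 < ev G (base (point (base x) s)) :=
    (by positivity : 0 < ε * (√q / δ)).trans_le (hG _)
  have hpos := pos_of_polQ_nonpos hm hG0 hQ
  have hGs := le_last_of_polQ_nonpos hm (by simpa using hs.le) hG0 hQ
  rw [base_point, point_last] at hGs
  rw [base_point, thicken_pos_iff] at hpos
  refine ⟨foot_mem_setD hε hpos.1, mem_coneOver_foot.2 ?_⟩
  calc ‖zPart x‖ ≤ √q * ε := by
        simpa using norm_le_sqrt_card_mul hε.le fun j => (hpos.2 j).le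
    _ = δ * (ε * (√q / δ)) := by field_simp
    _ ≤ δ * x (Fin.last _) := by gcongr; exact (hG _).trans (hGs.trans hsx)

theorem setS_subset_coneOver_setD (hq : q ≠ 0) (hε : 0 < ε) (hδ : 0 < δ)
    (hG : ∀ x', ε * (√q / δ) ≤ ev G x') :
    setS (thicken g ε) G ⊆ coneOver δ (setD (q := q) g ε) := fun _ hx =>
  have h := foot_mem_setD_and_mem_coneOver_foot hq hε hδ hG hx
  coneOver_mono (Set.singleton_subset_iff.2 h.1) h.2

theorem image_coneMap_setS_subset_coneOver_setD (hq : q ≠ 0) (hε : 0 < ε) (hδ : 0 < δ)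
    (hG : ∀ x', ε * (√q / δ) ≤ ev G x') (Q : MvPolynomial (Fin (d + q + 1)) ℝ) (k : ℕ) :
    coneMap P Q k '' setS (thicken g ε) G ⊆ coneOver (2 * δ) (setD g ε) := by
  rintro _ ⟨x, hx, rfl⟩
  obtain ⟨hfoot, hcone⟩ := foot_mem_setD_and_mem_coneOver_foot hq hε hδ hG hx
  exact coneOver_mono (Set.singleton_subset_iff.2 hfoot) (coneMap_mem_coneOver_foot hcone)

theorem posCylinder_setD_subset_image_coneMap (hm : r + q + q ≠ 0) (hε : 0 < ε)
    (hG : ∀ x', 1 ≤ ev G x') (hP : ∀ x ∈ setS (thicken g ε) G, 1 ≤ ev P x) {k : ℕ} (hk : k ≠ 0) :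
    posCylinder (setD g ε) (en (d + q)) ⊆
      coneMap P (polQ (thicken g ε) G) k '' setS (thicken g ε) G := by
  rintro _ ⟨u, hu, c, hc, rfl⟩
  obtain ⟨-, huz, hulast⟩ := (mem_setD hε).1 hu
  obtain ⟨t, htS, htc⟩ := exists_mem_setS_ev_polB_mul_eq hm hk (hG (base u)) hu.1.1 hP hc
  refine ⟨_, htS, ?_⟩
  have hcyl : u + c • en (d + q) = point (base u) c := by
    nth_rw 1 [← point_base_last u]
    rw [point_add_smul_en, hulast, zero_add]
  rw [hcyl]
  refine eq_of_parts_eq ?_ ?_ ?_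
  · rw [yPart_coneMap, yPart_point_base, yPart_point_base]
  · rw [zPart_coneMap, zPart_point_base, zPart_point_base, huz, smul_zero]
  · rw [coneMap_last, point_last, point_last, htc]

theorem coneMap_mem_coneOver_singleton (hε : 0 < ε) (hδ : 0 ≤ δ) (hΔ : 0 < Δ) {k : ℕ}
    (hk : Δ ≤ k * δ) (hx : x ∈ coneOver Δ (setD g ε) \ setS (thicken g ε) G) :
    coneMap P (polQ (thicken g ε) G) k x ∈ coneOver (2 * δ) {x} := by
  have hz := norm_zPart_le_of_mem_coneOver_setD hε hx.1
  have hlast : 0 ≤ x (Fin.last _) := nonneg_of_mul_nonneg_right ((norm_nonneg _).trans hz) hΔ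
  obtain hzero | hpos := hlast.eq_or_lt
  · rw [← hzero, mul_zero, norm_le_zero_iff] at hz
    rw [mem_coneOver_singleton_of_yPart_eq (yPart_coneMap ..), zPart_coneMap, coneMap_last, hz,
      ← hzero]
    simp
  · refine coneMap_mem_coneOver_self hδ hk hlast ?_ hz
    by_contra! hQ
    exact hx.2 (mem_setS.2 ⟨_, hpos, le_rfl, by simpa using hQ.le⟩)

end Thicken

end PolyCone

theorem theorem3p6 (d q r : ℕ) (hd : 1 ≤ d) (hq : 1 ≤ q)
    (g : Fin r → MvPolynomial (Fin d) ℝ)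
    (G : MvPolynomial (Fin (d + q)) ℝ)
    (P : MvPolynomial (Fin (d + q + 1)) ℝ)
    (ε δ : ℝ) (hε : 0 < ε) (hδ : 0 < δ)
    (hG : ∀ x' : EuclideanSpace ℝ (Fin (d + q)), 1 + ε * (Real.sqrt q / δ) ≤ ev G x')
    (hP : ∀ x ∈ setS (thicken (q := q) g ε) G, 1 < ev P x) :
    (∀ k : ℕ, 1 ≤ k → ∀ x' : EuclideanSpace ℝ (Fin (d + q)),
      Tendsto (fun t : ℝ => ev (polB P (polQ (thicken g ε) G) k) (point x' t) * t) atTop atTop) ∧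
    setS (thicken g ε) G ⊆ coneOver δ (setD (q := q) g ε) ∧
    (∀ k : ℕ, 1 ≤ k →
      posCylinder (setD g ε) (en (d + q)) ⊆
        coneMap P (polQ (thicken g ε) G) k '' setS (thicken g ε) G ∧
      coneMap P (polQ (thicken g ε) G) k '' setS (thicken g ε) G ⊆
        coneOver (2 * δ) (setD g ε)) ∧
    (∀ Δ : ℝ, 2 * δ < Δ → ∃ k₀ : ℕ, 1 ≤ k₀ ∧ ∀ k : ℕ, k₀ ≤ k →
      ∀ x ∈ coneOver Δ (setD g ε) \ setS (thicken g ε) G,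
        coneMap P (polQ (thicken g ε) G) k x ∈ coneOver (2 * δ) {x}) := by
  have hr : 0 ≤ ε * (√q / δ) := by positivity
  have hG1 : ∀ x', 1 ≤ ev G x' := fun x' => by linarith [hG x']
  have hGr : ∀ x', ε * (√q / δ) ≤ ev G x' := fun x' => by linarith [hG x']
  have hq0 : q ≠ 0 := by omega
  have hm : r + q + q ≠ 0 := by omega
  refine ⟨fun k _ x' => ?_, setS_subset_coneOver_setD hq0 hε hδ hGr, fun k hk => ⟨?_, ?_⟩,
    fun Δ hΔ => ⟨max 1 ⌈Δ / δ⌉₊, le_max_left _ _, fun k hk x hx => ?_⟩⟩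
  · exact tendsto_ev_polB_mul_atTop P k
      ((eventually_polQ_pos hm _ (one_pos.trans_le (hG1 x'))).mono fun _ => le_of_lt)
  · exact posCylinder_setD_subset_image_coneMap hm hε hG1 (fun x hx => (hP x hx).le) (by omega)
  · exact image_coneMap_setS_subset_coneOver_setD hq0 hε hδ hGr _ k
  · exact coneMap_mem_coneOver_singleton hε hδ.le (by linarith)
      ((div_le_iff₀ hδ).1 (Nat.ceil_le.1 ((le_max_right _ _).trans hk))) hx
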